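/- Define polynomials $S_n(q)\in\mathbb Z[q]$ ($n\ge 0$) by $S_0(q)=1$ and, for $n\ge 1$, $$S_n(q)=q^{2n-1}S_{n-1}(q)+\sum_{k=0}^{n-1}q^{2(k+1)(n-1-k)}S_{n-1-k}(q)\,S_k(q),$$ and for integers $t\ge 0$, $n\ge 1$ let $S^{(t)}_n(q)$ be the $n\times n$ matrix $$S^{(t)}_n(q)=\left(q^{(i-j)(i-j-1)}S_{i+j+t}(q)\right)_{0\le i,j\le n-1}.$$ Then for every positive integer $n$, $$\det S^{(3)}_n(1)=2^{\binom{n+3}{2}}-(2n+3)\,2^{\binom{n+2}{2}}-2^{\binom{n+1}{2}}.$$ -/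

import Mathlib

/-- The `q`-Schröder numbers `S_n(q)`, for an element `q` of a commutative ring:
`S_0(q) = 1` and, for `n ≥ 1`,
`S_n(q) = q^(2n-1) S_{n-1}(q) + ∑_{k=0}^{n-1} q^(2(k+1)(n-1-k)) S_{n-1-k}(q) S_k(q)`.
The second equation is written with `n = m + 1`, and `k` ranges over `0, …, m`, so that
the natural-number subtraction `m - k` is the true one. -/
def qSchroder {R : Type*} [CommRing R] (q : R) : ℕ → R
  | 0 => 1
  | m + 1 => q ^ (2 * m + 1) * qSchroder q m +
      ∑ k : Fin (m + 1), q ^ (2 * ((k : ℕ) + 1) * (m - (k : ℕ))) *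
        qSchroder q (m - (k : ℕ)) * qSchroder q (k : ℕ)
  decreasing_by all_goals omega

/-- The exponent `(i - j)(i - j - 1)` used below is never negative. -/
theorem qSchroder_exponent_nonneg (i j : ℤ) : 0 ≤ (i - j) * (i - j - 1) := by
  rcases le_or_gt (i - j) 0 with h | h
  · exact mul_nonneg_of_nonpos_of_nonpos h (by omega)
  · exact mul_nonneg (by omega) (by omega)

/-- The `n × n` matrix `S^{(t)}_n(q) = (q^((i-j)(i-j-1)) S_{i+j+t}(q))_{0 ≤ i, j ≤ n-1}`.
The exponent is computed in `ℤ`, where it is nonnegative, and then read as a natural number. -/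
def qSchroderMatrix {R : Type*} [CommRing R] (t n : ℕ) (q : R) : Matrix (Fin n) (Fin n) R :=
  Matrix.of fun i j =>
    q ^ ((((i : ℕ) : ℤ) - ((j : ℕ) : ℤ)) * (((i : ℕ) : ℤ) - ((j : ℕ) : ℤ) - 1)).toNat *
      qSchroder q ((i : ℕ) + (j : ℕ) + t)

/-!
At `q = 1` the matrix is the Hankel matrix `(r_{i+j+3})` of the large Schröder numbers `r_n`.
Write `h_t(n)` for the determinant of `(r_{i+j+t})_{i,j<n}`.

The values of `h_0` and `h_1` come from an `L D Lᵀ` factorisation. If an infinite lower triangular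
array is generated row by row by a tridiagonal matrix with diagonal `s` and constant products `t` of
opposite off-diagonal entries, then its column `0` is a moment sequence whose Hankel determinants
are `t ^ (n choose 2)` (`det_hankel_of_tridiagonal`). Such arrays arise from power series: the `k`-th
column is given by `P * (X * W) ^ k`, where `W = 1 + 3XW + 2X²W²` (`det_hankel_coeff`). With
`R = ∑ r_n Xⁿ` and `R = 1 + 2XW`, the functional equation `R = 1 + XR + XR²` gives the one for `W`.
Taking `P = R` yields `h_0(n) = 2 ^ (n choose 2)`, and taking `P = W` yields
`h_1(n) = 2 ^ (n + 1 choose 2)`.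

The Desnanot–Jacobi identity (`det_mul_det_interior`) for Hankel matrices reads
`h_t(n+2) h_{t+2}(n) = h_t(n+1) h_{t+2}(n+1) - h_{t+1}(n+1)²`. Since `h_0` and `h_1` never vanish, it
is a first-order recurrence in `n` that determines `h_2` from `h_0` and `h_1`, and then `h_3` from
`h_1` and `h_2`.
-/

/-! ### The Desnanot–Jacobi identity -/

/-- **Jacobi's complementary minor formula** for a principal block, multiplied by `det M`. It is the
determinant of the identity `M * (first block column of adj M, last block column of 1) =
(first block column of det M • 1, last block column of M)`. -/
theorem det_mul_det_toBlocks₁₁_adjugate {R m n : Type*} [CommRing R] [Fintype m] [DecidableEq m]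
    [Fintype n] [DecidableEq n] (M : Matrix (m ⊕ n) (m ⊕ n) R) :
    M.det * M.adjugate.toBlocks₁₁.det = M.det ^ Fintype.card m * M.toBlocks₂₂.det := by
  have h : M * Matrix.fromBlocks M.adjugate.toBlocks₁₁ 0 M.adjugate.toBlocks₂₁ 1 =
      Matrix.fromBlocks (M.det • 1) M.toBlocks₁₂ 0 M.toBlocks₂₂ := by
    have h1 := M.mul_adjugate
    rw [← Matrix.fromBlocks_toBlocks M.adjugate] at h1
    nth_rw 1 [← Matrix.fromBlocks_toBlocks M] at h1 ⊢
    rw [Matrix.fromBlocks_multiply, ← Matrix.fromBlocks_one, Matrix.fromBlocks_smul,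
      Matrix.fromBlocks_inj] at h1
    rw [Matrix.fromBlocks_multiply, h1.1, h1.2.2.1]
    simp
  have := congrArg Matrix.det h
  rw [Matrix.det_mul, Matrix.det_fromBlocks_zero₁₂, Matrix.det_fromBlocks_zero₂₁,
    Matrix.det_smul] at this
  simpa using this

/-- **Desnanot–Jacobi identity** (Dodgson condensation). -/
theorem det_mul_det_interior {R : Type*} [CommRing R] [IsDomain R] {n : ℕ}
    (M : Matrix (Fin (n + 2)) (Fin (n + 2)) R) (hM : M.det ≠ 0) :
    M.det * (M.submatrix (fun i : Fin n => i.succ.castSucc) fun i => i.succ.castSucc).det =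
      (M.submatrix Fin.castSucc Fin.castSucc).det * (M.submatrix Fin.succ Fin.succ).det -
        (M.submatrix Fin.castSucc Fin.succ).det * (M.submatrix Fin.succ Fin.castSucc).det := by
  -- Reorder the indices so that the two corners come first.
  let f : Fin 2 ⊕ Fin n → Fin (n + 2) := Sum.elim ![0, Fin.last _] fun i => i.succ.castSucc
  have hf : Function.Bijective f := by
    rw [Fintype.bijective_iff_injective_and_card]
    refine ⟨?_, by simp [add_comm]⟩
    rintro (i | i) (j | j) h
    · fin_cases i <;> fin_cases j <;> simp [f, Fin.ext_iff] at h ⊢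
    · have := j.2
      fin_cases i <;> simp [f, Fin.ext_iff] at h
      omega
    · have := i.2
      fin_cases j <;> simp [f, Fin.ext_iff] at h
      omega
    · simpa [f, Fin.ext_iff] using h
  let e := Equiv.ofBijective f hf
  have key := det_mul_det_toBlocks₁₁_adjugate (M.submatrix e e)
  rw [Matrix.adjugate_submatrix_equiv_self, Matrix.det_submatrix_equiv_self, Matrix.det_fin_two,
    Fintype.card_fin, pow_two, mul_assoc] at key
  have key := mul_left_cancel₀ hM key
  have h0 : e (Sum.inl 0) = 0 := rfl
  have h1 : e (Sum.inl 1) = Fin.last _ := rfl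
  have hs : (M.submatrix e e).toBlocks₂₂ =
      M.submatrix (fun i : Fin n => i.succ.castSucc) fun i => i.succ.castSucc := rfl
  rw [hs] at key
  rw [← key]
  simp only [Matrix.toBlocks₁₁, Matrix.of_apply, Matrix.submatrix_apply, h0, h1,
    Matrix.adjugate_fin_succ_eq_det_submatrix, Fin.succAbove_zero, Fin.succAbove_last]
  -- The off-diagonal cofactors carry the sign `(-1) ^ (n + 1)` each.
  have hsign : ((-1 : R) ^ (n + 1)) * (-1) ^ (n + 1) = 1 := by
    rw [← mul_pow]; simp
  simp only [Fin.val_zero, Fin.val_last, Nat.succ_eq_add_one, add_zero, zero_add, pow_zero, one_mul,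
    pow_add _ (n + 1) (n + 1), hsign]
  linear_combination (-(M.submatrix Fin.castSucc Fin.succ).det *
    (M.submatrix Fin.succ Fin.castSucc).det) * hsign

/-! ### Hankel matrices -/

/-- The `n × n` Hankel matrix `(a_{i+j+t})` of the sequence `a`, shifted by `t`. -/
def hankel {R : Type*} (a : ℕ → R) (t n : ℕ) : Matrix (Fin n) (Fin n) R :=
  Matrix.of fun i j => a (i + j + t)

theorem det_hankel_mul_det_hankel {R : Type*} [CommRing R] [IsDomain R] (a : ℕ → R) (t n : ℕ)
    (h : (hankel a t (n + 2)).det ≠ 0) :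
    (hankel a t (n + 2)).det * (hankel a (t + 2) n).det =
      (hankel a t (n + 1)).det * (hankel a (t + 2) (n + 1)).det -
        (hankel a (t + 1) (n + 1)).det ^ 2 := by
  have hinner : (hankel a t (n + 2)).submatrix (fun i : Fin n => i.succ.castSucc)
      (fun i => i.succ.castSucc) = hankel a (t + 2) n := by
    ext i j
    simp only [hankel, Matrix.of_apply, Matrix.submatrix_apply, Fin.val_castSucc, Fin.val_succ]
    congr 1
    omega
  have h₀ : (hankel a t (n + 2)).submatrix Fin.castSucc Fin.castSucc = hankel a t (n + 1) := rfl
  have h₁ : (hankel a t (n + 2)).submatrix Fin.castSucc Fin.succ = hankel a (t + 1) (n + 1) := by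
    ext i j
    simp only [hankel, Matrix.of_apply, Matrix.submatrix_apply, Fin.val_castSucc, Fin.val_succ]
    congr 1
    omega
  have h₁' : (hankel a t (n + 2)).submatrix Fin.succ Fin.castSucc = hankel a (t + 1) (n + 1) := by
    ext i j
    simp only [hankel, Matrix.of_apply, Matrix.submatrix_apply, Fin.val_castSucc, Fin.val_succ]
    congr 1
    omega
  have h₂ : (hankel a t (n + 2)).submatrix Fin.succ Fin.succ = hankel a (t + 2) (n + 1) := by
    ext i j
    simp only [hankel, Matrix.of_apply, Matrix.submatrix_apply, Fin.val_succ]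
    congr 1
    omega
  have key := det_mul_det_interior (hankel a t (n + 2)) h
  rwa [hinner, h₀, h₁, h₁', h₂, ← pow_two] at key

section Tridiagonal

variable {R : Type*} [CommRing R] {A : ℕ → ℕ → R} {s : ℕ → R} {t : R}

/-- Up to a boundary term, the tridiagonal operator is symmetric for the weights `t ^ k`. -/
theorem sum_tridiagonal_sub
    (hA0 : ∀ n, A (n + 1) 0 = s 0 * A n 0 + t * A n 1)
    (hA : ∀ n k, A (n + 1) (k + 1) = A n k + s (k + 1) * A n (k + 1) + t * A n (k + 2))
    (i j N : ℕ) :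
    ∑ k ∈ Finset.range (N + 1), t ^ k * (A (i + 1) k * A j k - A i k * A (j + 1) k) =
      t ^ (N + 1) * (A i (N + 1) * A j N - A i N * A j (N + 1)) := by
  induction N with
  | zero =>
    simp only [zero_add, Finset.range_one, Finset.sum_singleton, hA0]
    ring
  | succ N ih =>
    rw [Finset.sum_range_succ, ih, hA, hA]
    ring

theorem tridiagonal_eq_zero (h0 : ∀ k, A 0 (k + 1) = 0)
    (hA : ∀ n k, A (n + 1) (k + 1) = A n k + s (k + 1) * A n (k + 1) + t * A n (k + 2))
    {n k : ℕ} (h : n < k) : A n k = 0 := by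
  induction n generalizing k with
  | zero => obtain ⟨k, rfl⟩ := Nat.exists_eq_succ_of_ne_zero h.ne'; exact h0 k
  | succ n ih =>
    obtain ⟨k, rfl⟩ := Nat.exists_eq_succ_of_ne_zero (Nat.ne_zero_of_lt h)
    rw [Nat.succ_eq_add_one, hA, ih (by omega), ih (by omega), ih (by omega)]
    ring

theorem tridiagonal_diag (h00 : A 0 0 = 1) (h0 : ∀ k, A 0 (k + 1) = 0)
    (hA : ∀ n k, A (n + 1) (k + 1) = A n k + s (k + 1) * A n (k + 1) + t * A n (k + 2)) (n : ℕ) :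
    A n n = 1 := by
  induction n with
  | zero => exact h00
  | succ n ih =>
    rw [hA, ih, tridiagonal_eq_zero h0 hA (Nat.lt_succ_self n),
      tridiagonal_eq_zero h0 hA (by omega : n < n + 2)]
    ring

/-- The orthogonality relation of the rows: column `0` is the moment sequence. -/
theorem sum_tridiagonal_mul (h00 : A 0 0 = 1) (h0 : ∀ k, A 0 (k + 1) = 0)
    (hA0 : ∀ n, A (n + 1) 0 = s 0 * A n 0 + t * A n 1)
    (hA : ∀ n k, A (n + 1) (k + 1) = A n k + s (k + 1) * A n (k + 1) + t * A n (k + 2))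
    {i N : ℕ} (hi : i ≤ N) (j : ℕ) :
    ∑ k ∈ Finset.range (N + 1), t ^ k * (A i k * A j k) = A (i + j) 0 := by
  induction i generalizing j with
  | zero => simp [Finset.sum_range_succ', h00, h0]
  | succ i ih =>
    have h := sum_tridiagonal_sub hA0 hA i j N
    rw [tridiagonal_eq_zero h0 hA (by omega : i < N), tridiagonal_eq_zero h0 hA
      (by omega : i < N + 1)] at h
    simp only [mul_sub, Finset.sum_sub_distrib, zero_mul, sub_zero, mul_zero] at h
    rw [sub_eq_zero.1 h, ih (by omega)]
    congr 1
    omega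

/-- If the rows of `A` are generated by a tridiagonal matrix, then the Hankel matrix of column `0`
of `A` is `L D Lᵀ` with `L` a unitriangular corner of `A` and `D` the diagonal of the `t ^ k`. -/
theorem det_hankel_of_tridiagonal (h00 : A 0 0 = 1) (h0 : ∀ k, A 0 (k + 1) = 0)
    (hA0 : ∀ n, A (n + 1) 0 = s 0 * A n 0 + t * A n 1)
    (hA : ∀ n k, A (n + 1) (k + 1) = A n k + s (k + 1) * A n (k + 1) + t * A n (k + 2)) (n : ℕ) :
    (hankel (fun m => A m 0) 0 n).det = t ^ n.choose 2 := by
  obtain _ | N := n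
  · simp
  let L : Matrix (Fin (N + 1)) (Fin (N + 1)) R := Matrix.of fun i k => A i k
  have hL : L.det = 1 := by
    rw [Matrix.det_of_isLowerTriangular L fun i k hik => tridiagonal_eq_zero h0 hA hik]
    exact Finset.prod_eq_one fun i _ => tridiagonal_diag h00 h0 hA i
  have hfac : hankel (fun m => A m 0) 0 (N + 1) =
      L * Matrix.diagonal (fun k : Fin (N + 1) => t ^ (k : ℕ)) * L.transpose := by
    ext i j
    rw [Matrix.mul_apply]
    simp only [Matrix.mul_diagonal, Matrix.transpose_apply, L, Matrix.of_apply, hankel, add_zero]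
    rw [← sum_tridiagonal_mul h00 h0 hA0 hA (Nat.lt_succ_iff.1 i.2) j, Finset.sum_range]
    exact Finset.sum_congr rfl fun k _ => by ring
  rw [hfac, Matrix.det_mul, Matrix.det_mul, Matrix.det_transpose, hL, Matrix.det_diagonal, one_mul,
    mul_one, Finset.prod_pow_eq_pow_sum, Fin.sum_univ_eq_sum_range (fun i => i) (N + 1),
    Finset.sum_range_id, Nat.choose_two_right]

end Tridiagonal

open PowerSeries in
/-- Hankel determinants of the coefficients of `P = 1 + X (s₀ P + t X P W)`, where
`W = 1 + s X W + t X² W²`: the `k`-th column of the tridiagonal array consists of the coefficients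
of `P * (X * W) ^ k`. -/
theorem det_hankel_coeff {R : Type*} [CommRing R] {s₀ s t : R} {P W : PowerSeries R}
    (hP : P = 1 + X * (C s₀ * P + C t * (P * (X * W))))
    (hW : W = 1 + C s * (X * W) + C t * (X * W) ^ 2) (n : ℕ) :
    (hankel (fun m => coeff m P) 0 n).det = t ^ n.choose 2 := by
  have key := det_hankel_of_tridiagonal (A := fun n k => coeff n (P * (X * W) ^ k))
    (s := fun k => if k = 0 then s₀ else s) (t := t) ?_ ?_ ?_ ?_ n
  · simpa using key
  · have := congrArg (coeff 0) hP
    simpa using this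
  · intro k
    simp
  · intro n
    have := congrArg (coeff (n + 1)) hP
    simpa [coeff_succ_X_mul, coeff_one] using this
  · intro n k
    have h : P * (X * W) ^ (k + 1) = X * (P * (X * W) ^ k + C s * (P * (X * W) ^ (k + 1)) +
        C t * (P * (X * W) ^ (k + 2))) := by
      linear_combination (P * (X * W) ^ k * X) * hW
    have := congrArg (coeff (n + 1)) h
    rw [coeff_succ_X_mul, map_add, map_add, coeff_C_mul, coeff_C_mul] at this
    simpa using this

/-! ### Schröder numbers -/

theorem qSchroder_one_eq_largeSchroder (n : ℕ) :
    qSchroder (1 : ℤ) n = (Nat.largeSchroder n : ℤ) := by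
  induction n using Nat.strong_induction_on with
  | _ n ih =>
    obtain _ | m := n
    · simp [qSchroder]
    · rw [qSchroder, Nat.largeSchroder, ih m (by omega)]
      push_cast
      simp only [one_pow, one_mul]
      congr 1
      refine Finset.sum_congr rfl fun k _ => ?_
      rw [ih _ (by omega), ih _ (by omega), mul_comm]

/-- The large Schröder numbers as integers. -/
def schroder (n : ℕ) : ℤ := Nat.largeSchroder n

open PowerSeries in
/-- The generating function of the large Schröder numbers. -/
def schroderSeries : PowerSeries ℤ := mk schroder

open PowerSeries in
/-- The generating function of the halves of the large Schröder numbers from index `1` on; the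
integer division is exact. -/
def halfSchroderSeries : PowerSeries ℤ := mk fun n => schroder (n + 1) / 2

theorem schroder_succ_eq_two_mul (n : ℕ) : schroder (n + 1) = 2 * (schroder (n + 1) / 2) := by
  have h : Even (schroder (n + 1)) := by
    exact (Int.even_coe_nat _).2 (Nat.even_largeSchroder n.succ_ne_zero)
  exact (Int.mul_ediv_cancel' h.two_dvd).symm

open PowerSeries in
theorem schroderSeries_eq :
    schroderSeries = 1 + X * schroderSeries + X * schroderSeries ^ 2 := by
  ext n
  obtain _ | n := n
  · simp [schroderSeries, schroder]
  · rw [map_add, map_add, coeff_succ_X_mul, coeff_succ_X_mul, pow_two, coeff_mul,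
      Finset.Nat.sum_antidiagonal_eq_sum_range_succ_mk, coeff_one, if_neg n.succ_ne_zero]
    simp only [schroderSeries, coeff_mk, schroder, Nat.largeSchroder, Nat.succ_eq_add_one]
    push_cast
    rw [Finset.sum_range]
    ring

open PowerSeries in
theorem schroderSeries_eq_halfSchroderSeries :
    schroderSeries = 1 + 2 * (X * halfSchroderSeries) := by
  ext n
  obtain _ | n := n
  · simp [schroderSeries, schroder]
  · rw [map_add, show (2 : PowerSeries ℤ) = C 2 from rfl, coeff_C_mul, coeff_succ_X_mul, coeff_one,
      if_neg n.succ_ne_zero, zero_add]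
    simp only [schroderSeries, halfSchroderSeries, coeff_mk]
    exact schroder_succ_eq_two_mul n

open PowerSeries in
theorem halfSchroderSeries_eq :
    halfSchroderSeries = 1 + 3 * (X * halfSchroderSeries) + 2 * (X * halfSchroderSeries) ^ 2 := by
  have h := schroderSeries_eq
  rw [schroderSeries_eq_halfSchroderSeries] at h
  have h2 : (2 * X : PowerSeries ℤ) ≠ 0 :=
    mul_ne_zero ((map_ne_zero_iff (C (R := ℤ)) C_injective).2 two_ne_zero) X_ne_zero
  -- Substituting `R = 1 + 2XW` in `R = 1 + XR + XR²` gives `2X` times the claim.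
  refine mul_left_cancel₀ h2 ?_
  linear_combination h

open PowerSeries in
theorem det_hankel_schroder_zero (n : ℕ) : (hankel schroder 0 n).det = 2 ^ n.choose 2 := by
  have h := det_hankel_coeff (s₀ := 2) (s := 3) (t := 2) (P := schroderSeries)
    (W := halfSchroderSeries) ?_ halfSchroderSeries_eq n
  · simpa [schroderSeries] using h
  · rw [show (C 2 : PowerSeries ℤ) = 2 from rfl]
    linear_combination schroderSeries_eq +
      X * schroderSeries * schroderSeries_eq_halfSchroderSeries

open PowerSeries in
theorem det_hankel_schroder_one (n : ℕ) :
    (hankel schroder 1 n).det = 2 ^ (n + 1).choose 2 := by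
  have h := det_hankel_coeff (s₀ := 3) (s := 3) (t := 2) (P := halfSchroderSeries)
    (W := halfSchroderSeries) ?_ halfSchroderSeries_eq n
  · have hs : hankel schroder 1 n =
        (2 : ℤ) • hankel (fun m => coeff m halfSchroderSeries) 0 n := by
      ext i j
      simpa [hankel, halfSchroderSeries] using schroder_succ_eq_two_mul (i + j)
    rw [hs, Matrix.det_smul, h, Fintype.card_fin, ← pow_add, Nat.choose_succ_succ' n 1,
      Nat.choose_one_right]
  · rw [show (C 2 : PowerSeries ℤ) = 2 from rfl, show (C 3 : PowerSeries ℤ) = 3 from rfl]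
    linear_combination halfSchroderSeries_eq

theorem two_pow_choose_two_succ (n : ℕ) :
    (2 : ℤ) ^ (n + 1).choose 2 = 2 ^ n * 2 ^ n.choose 2 := by
  rw [Nat.choose_succ_succ' n 1, Nat.choose_one_right, pow_add]

theorem det_hankel_schroder_two (n : ℕ) :
    (hankel schroder 2 n).det = 2 ^ (n + 2).choose 2 - 2 ^ (n + 1).choose 2 := by
  induction n with
  | zero => simp
  | succ n ih =>
    -- The recurrence `h₀(n+1) h₂(n+1) = h₀(n+2) h₂(n) + h₁(n+1)²`.
    have h := det_hankel_mul_det_hankel schroder 0 n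
      (by rw [det_hankel_schroder_zero]; positivity)
    simp only [zero_add] at h
    rw [det_hankel_schroder_zero, det_hankel_schroder_zero, det_hankel_schroder_one, ih] at h
    refine mul_left_cancel₀ (pow_ne_zero ((n + 1).choose 2) (two_ne_zero (α := ℤ))) ?_
    rw [eq_add_of_sub_eq h.symm]
    simp only [two_pow_choose_two_succ (n + 2), two_pow_choose_two_succ (n + 1), add_assoc,
      Nat.reduceAdd]
    ring

theorem det_hankel_schroder_three (n : ℕ) :
    (hankel schroder 3 n).det =
      2 ^ (n + 3).choose 2 - (2 * (n : ℤ) + 3) * 2 ^ (n + 2).choose 2 - 2 ^ (n + 1).choose 2 := by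
  induction n with
  | zero => simp [Nat.choose]
  | succ n ih =>
    -- The recurrence `h₁(n+1) h₃(n+1) = h₁(n+2) h₃(n) + h₂(n+1)²`.
    have h := det_hankel_mul_det_hankel schroder 1 n
      (by rw [det_hankel_schroder_one]; positivity)
    simp only [Nat.reduceAdd] at h
    rw [det_hankel_schroder_one, det_hankel_schroder_one, det_hankel_schroder_two, ih] at h
    refine mul_left_cancel₀ (pow_ne_zero ((n + 1 + 1).choose 2) (two_ne_zero (α := ℤ))) ?_
    rw [eq_add_of_sub_eq h.symm]
    push_cast
    simp only [add_assoc, Nat.reduceAdd]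
    simp only [two_pow_choose_two_succ (n + 3), two_pow_choose_two_succ (n + 2),
      two_pow_choose_two_succ (n + 1)]
    ring

theorem mainTheorem4 (n : ℕ) (hn : 0 < n) :
    (qSchroderMatrix 3 n (1 : ℤ)).det =
      2 ^ (n + 3).choose 2 - (2 * (n : ℤ) + 3) * 2 ^ (n + 2).choose 2
        - 2 ^ (n + 1).choose 2 := by
  rw [← det_hankel_schroder_three]
  congr 1
  ext i j
  simp [qSchroderMatrix, hankel, schroder, qSchroder_one_eq_largeSchroder]
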